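/- For positive integers $m\le n$, let $\mathrm{PF}(m,n)$ be the set of parking functions of $m$ cars on $n$ spots: the sequences $(\pi_1,\dots,\pi_m)\in\{1,\dots,n\}^m$ such that, when cars $1,\dots,m$ enter in this order a one-way street with spots $1,\dots,n$, and car $i$ parks in the first unoccupied spot at or after its preferred spot $\pi_i$, all cars are able to park. Fix $0<c<1$ and let $m$ and $n$ tend to infinity with $m/n\to c$ (for example $m=cn$, or $m=\lfloor cn\rfloor$). For $\pi$ chosen uniformly at random from $\mathrm{PF}(m,n)$, $$\operatorname{Var}(\pi_1)=\frac{1}{12}n^2-\frac{c}{6(1-c)}\,n+o(n),\qquad \operatorname{Cov}(\pi_1,\pi_2)\sim-\frac{1}{4(1-c)^2},$$ where $\sim$ means that the ratio of the two sides tends to $1$. -/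

import Mathlib

open Filter Topology Asymptotics ProbabilityTheory MeasureTheory

namespace Parking

/-- Cars `0, …, m - 1` enter, in this order, a one-way street with spots `0, …, n - 1`, and car `i`
prefers spot `π i`. The map `τ` is the outcome, with every car parked: car `i` takes the first spot
at or after `π i` that no earlier car occupies. -/
def IsOutcome {m n : ℕ} (π τ : Fin m → Fin n) : Prop :=
  ∀ i : Fin m, IsLeast {s : Fin n | π i ≤ s ∧ ∀ j : Fin m, j < i → τ j ≠ s} (τ i)

/-- `PF m n`: the preference lists of `m` cars on `n` spots for which all cars park. -/
def PF (m n : ℕ) : Set (Fin m → Fin n) :=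
  {π | ∃ τ : Fin m → Fin n, IsOutcome π τ}

/-- The uniform probability measure on `PF m n`. -/
noncomputable def unifPF (m n : ℕ) : Measure (Fin m → Fin n) :=
  uniformOn (PF m n)

/-- The preference of car `i` as a real random variable, where the spots are numbered `1, …, n`. -/
def pref {m n : ℕ} (i : Fin m) (π : Fin m → Fin n) : ℝ :=
  ((π i : ℕ) : ℝ) + 1

end Parking

/-!
Parking functions do not depend on the order of the cars: `π` lets all cars park exactly when, for
every `s`, at most `s` cars prefer one of the last `s` spots (`mem_PF_iff`). So the cars in question
can be inserted last. Number the spots `0, …, n - 1` from the far end, and let `L` and `M` be the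
last and the last but one spot that the other cars leave empty (`emptySpot f 0`, `emptySpot f 1`).
One inserted car is uniform on `[L, n)`; two inserted cars are uniform on the pairs in `[L, n)²`
outside `[L, M)²`. Hence the moments of the preferences are averages, over parking functions of
fewer cars, of polynomials in `L` and `M`.

Exchanging the blocks of lengths `L + 1` and `M - L` is an involution, so that these lengths are
equidistributed (`sum_emptySpot_one_sub`). Counting the insertions of two cars, at once or one after
the other, then gives `∑ (L + 1) = (n + 1) ^ m` and the number of parking functions by recursion
(`sum_emptySpot_add_one_and_card`); in particular `E L = m / (n + 1 - m)`, with limit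
`l = c / (1 - c)`. The probability that `L = s` is exponentially small in `s`, because `s` of
the cars must prefer one of `s` given spots; so `E (L + 1) ^ 3` is bounded
(`exists_sum_emptySpot_pow_le`).

Measured from the middle of the street, one inserted car has mean about `l / 2` and second moment
`n ^ 2 / 12 - l n / 6 + o(n)`. The product of two inserted cars has mean about
`(E L ^ 2 - E (M - L) ^ 2) / 4`; here equidistribution cancels the second moments and leaves
`-(2 l + 1) / 4`. Therefore the covariance tends to `-(2 l + 1) / 4 - l ^ 2 / 4 = -(l + 1) ^ 2 / 4`,
and `l + 1 = 1 / (1 - c)`.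
-/

namespace Parking

/-! ### Parking functions through counting -/

/-- The number of indices at which `f` takes a value below `s`. -/
def countBelow {m n : ℕ} (f : Fin m → Fin n) (s : ℕ) : ℕ :=
  (Finset.univ.filter fun i => (f i : ℕ) < s).card

/-- The parking functions of `m` cars on `n` spots with the spots numbered `0, …, n - 1` from the
far end of the street: at most `s` cars prefer one of the last `s` spots, for every `s`. -/
noncomputable def revPF (m n : ℕ) : Finset (Fin m → Fin n) :=
  letI := Classical.decPred fun f : Fin m → Fin n => ∀ s, countBelow f s ≤ s
  Finset.univ.filter fun f => ∀ s, countBelow f s ≤ s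

theorem mem_revPF {m n : ℕ} {f : Fin m → Fin n} : f ∈ revPF m n ↔ ∀ s, countBelow f s ≤ s := by
  simp [revPF]

theorem IsOutcome.injective {m n : ℕ} {π τ : Fin m → Fin n} (h : IsOutcome π τ) :
    Function.Injective τ := by
  intro i j hij
  rcases lt_trichotomy i j with hlt | heq | hlt
  · exact absurd hij ((h j).1.2 i hlt)
  · exact heq
  · exact absurd hij.symm ((h i).1.2 j hlt)

theorem IsOutcome.snoc {m n : ℕ} {π : Fin (m + 1) → Fin n} {τ : Fin m → Fin n} {s : Fin n}
    (h : IsOutcome (fun i => π i.castSucc) τ)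
    (hs : IsLeast {s : Fin n | π (Fin.last m) ≤ s ∧ ∀ j, τ j ≠ s} s) :
    IsOutcome π (Fin.snoc (α := fun _ => Fin n) τ s) := by
  intro i
  refine Fin.lastCases ?_ (fun i => ?_) i
  · rw [Fin.snoc_last]
    refine ⟨⟨hs.1.1, fun j => ?_⟩, fun t ht => hs.2 ⟨ht.1, fun j => ?_⟩⟩
    · refine Fin.lastCases (fun hj => absurd hj (lt_irrefl _)) (fun j _ => ?_) j
      rw [Fin.snoc_castSucc]
      exact hs.1.2 j
    · have := ht.2 j.castSucc (Fin.castSucc_lt_last j)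
      rwa [Fin.snoc_castSucc] at this
  · rw [Fin.snoc_castSucc]
    refine ⟨⟨(h i).1.1, fun j => ?_⟩, fun t ht => (h i).2 ⟨ht.1, fun j hj => ?_⟩⟩
    · refine Fin.lastCases (fun hj => ?_) (fun j hj => ?_) j
      · exact absurd (hj.trans (Fin.castSucc_lt_last i)) (lt_irrefl _)
      · rw [Fin.snoc_castSucc]
        exact (h i).1.2 j (by simpa using hj)
    · have := ht.2 j.castSucc (by simpa using hj)
      rwa [Fin.snoc_castSucc] at this

theorem countBelow_rev {m n : ℕ} (π : Fin m → Fin n) {p : ℕ} (hp : p ≤ n) :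
    countBelow (fun i => (π i).rev) (n - p) =
      (Finset.univ.filter fun i => p ≤ (π i : ℕ)).card := by
  unfold countBelow
  congr 1
  ext i
  have := (π i).isLt
  simp only [Finset.mem_filter, Finset.mem_univ, true_and, Fin.val_rev]
  omega

theorem card_filter_le_val {n p : ℕ} :
    (Finset.univ.filter fun s : Fin n => p ≤ (s : ℕ)).card = n - p := by
  rw [← Finset.card_map Fin.valEmbedding, ← Nat.card_Ico p n]
  congr 1
  ext t
  simp only [Finset.mem_map, Finset.mem_filter, Finset.mem_univ, true_and, Finset.mem_Ico,
    Fin.valEmbedding_apply]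
  exact ⟨fun ⟨s, hs, hst⟩ => hst ▸ ⟨hs, s.isLt⟩, fun ht => ⟨⟨t, ht.2⟩, ht.1, rfl⟩⟩

/-- If the cars already parked fill every spot from `p` on, with `p` least possible, then all of
those cars prefer a spot from `p` on, so one more such car would violate the counting condition. -/
theorem exists_isOutcome {m n : ℕ} (π : Fin m → Fin n)
    (h : ∀ s, countBelow (fun i => (π i).rev) s ≤ s) : ∃ τ, IsOutcome π τ := by
  classical
  induction m with
  | zero => exact ⟨π, fun i => i.elim0⟩
  | succ m ih =>
    obtain ⟨τ, hτ⟩ := ih (fun i => π i.castSucc) fun s => by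
      refine le_trans ?_ (h s)
      simp only [countBelow, Finset.card_filter, Fin.sum_univ_castSucc]
      omega
    suffices hne : {s : Fin n | π (Fin.last m) ≤ s ∧ ∀ j, τ j ≠ s}.Nonempty by
      exact ⟨_, hτ.snoc ⟨wellFounded_lt.min_mem _ hne,
        fun t ht => not_lt.1 (wellFounded_lt.not_lt_min _ ht)⟩⟩
    by_contra hemp
    have hfull : ∃ p : ℕ, ∀ s : Fin n, p ≤ s → ∃ j, τ j = s := by
      refine ⟨π (Fin.last m), fun s hs => ?_⟩
      by_contra! hne
      exact hemp ⟨s, hs, hne⟩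
    have hp := Nat.find_spec hfull
    have hple : Nat.find hfull ≤ π (Fin.last m) := by
      refine Nat.find_min' hfull fun s hs => ?_
      by_contra! hne
      exact hemp ⟨s, hs, hne⟩
    have hmin := fun q => Nat.find_min hfull (m := q)
    generalize Nat.find hfull = p at hp hple hmin
    have hpn : p ≤ n := hple.trans (π (Fin.last m)).isLt.le
    have hpref : ∀ j, p ≤ (τ j : ℕ) → p ≤ (π j.castSucc : ℕ) := by
      intro j hj
      by_contra! hlt
      have hnot := hmin (p - 1) (by omega)
      push Not at hnot
      obtain ⟨s, hs, hsne⟩ := hnot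
      have hsp : (s : ℕ) < p := by
        by_contra! hge
        obtain ⟨j, hj⟩ := hp s hge
        exact hsne j hj
      have := (hτ j).2 (show s ∈ _ from ⟨Fin.le_def.2 (by simp only; omega), fun j _ => hsne j⟩)
      have := Fin.le_def.1 this
      omega
    have hcard : n - p ≤ (Finset.univ.filter fun j => p ≤ (τ j : ℕ)).card := by
      rw [← card_filter_le_val]
      refine (Finset.card_le_card (t := (Finset.univ.filter fun j => p ≤ (τ j : ℕ)).image τ)
        fun s hs => ?_).trans Finset.card_image_le
      obtain ⟨j, hj⟩ := hp s (by simpa using hs)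
      exact Finset.mem_image.2 ⟨j, by simpa [hj] using hs, hj⟩
    have hmono : (Finset.univ.filter fun j => p ≤ (τ j : ℕ)).card ≤
        (Finset.univ.filter fun j : Fin m => p ≤ (π j.castSucc : ℕ)).card :=
      Finset.card_le_card (Finset.monotone_filter_right _ fun j _ => hpref j)
    have hs := h (n - p)
    rw [countBelow_rev π hpn, Finset.card_filter, Fin.sum_univ_castSucc, if_pos hple,
      ← Finset.card_filter] at hs
    omega

theorem mem_PF_iff {m n : ℕ} {π : Fin m → Fin n} :
    π ∈ PF m n ↔ (fun i => (π i).rev) ∈ revPF m n := by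
  classical
  rw [mem_revPF]
  refine ⟨fun ⟨τ, hτ⟩ s => ?_, exists_isOutcome π⟩
  -- The cars preferring one of the last `s` spots park in distinct spots among the last `s`.
  have hsub : (Finset.univ.filter fun i => ((π i).rev : ℕ) < s).image (fun i => ((τ i).rev : ℕ)) ⊆
      Finset.range s := by
    intro t ht
    obtain ⟨i, hi, rfl⟩ := Finset.mem_image.1 ht
    have h1 : (π i : ℕ) ≤ τ i := (hτ i).1.1
    simp only [Finset.mem_filter, Finset.mem_univ, true_and, Fin.val_rev, Finset.mem_range] at hi ⊢
    omega
  have := Finset.card_le_card hsub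
  rwa [Finset.card_image_of_injective (f := fun i => ((τ i).rev : ℕ)) _
    (Fin.val_injective.comp (Fin.rev_injective.comp hτ.injective)), Finset.card_range] at this

/-! ### The last two empty spots and the block swap -/

theorem countBelow_mono {m n : ℕ} (f : Fin m → Fin n) : Monotone (countBelow f) := fun _ _ h =>
  Finset.card_le_card (Finset.monotone_filter_right _ fun _ _ hi => lt_of_lt_of_le hi h)

theorem countBelow_le {m n : ℕ} (f : Fin m → Fin n) (s : ℕ) : countBelow f s ≤ m :=
  (Finset.card_filter_le _ _).trans (by simp)

theorem countBelow_add_card {m n : ℕ} (f : Fin m → Fin n) {a b : ℕ} (hab : a ≤ b) :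
    countBelow f a + (Finset.univ.filter fun i => a ≤ (f i : ℕ) ∧ (f i : ℕ) < b).card =
      countBelow f b := by
  classical
  unfold countBelow
  rw [← Finset.card_union_of_disjoint]
  · congr 1
    ext i
    simp only [Finset.mem_union, Finset.mem_filter, Finset.mem_univ, true_and]
    omega
  · rw [Finset.disjoint_left]
    intro i
    simp only [Finset.mem_filter, Finset.mem_univ, true_and]
    omega

/-- For `k = 0` or `1` and few enough cars, the `(k + 1)`-st empty spot of a parking function,
counted from the far end of the street, where the spots are numbered from `0`. In terms of counts:
the last `s ≤ n` for which at least `s - k` cars prefer one of the `s` last spots. -/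
def emptySpot {m n : ℕ} (f : Fin m → Fin n) (k : ℕ) : ℕ :=
  Nat.findGreatest (fun s => s ≤ countBelow f s + k) n

theorem emptySpot_le {m n : ℕ} (f : Fin m → Fin n) (k : ℕ) : emptySpot f k ≤ n :=
  Nat.findGreatest_le n

theorem le_countBelow_emptySpot {m n : ℕ} (f : Fin m → Fin n) (k : ℕ) :
    emptySpot f k ≤ countBelow f (emptySpot f k) + k :=
  Nat.findGreatest_spec (P := fun s => s ≤ countBelow f s + k) (Nat.zero_le n) (Nat.zero_le _)

theorem lt_of_emptySpot_lt {m n : ℕ} {f : Fin m → Fin n} {k s : ℕ} (hmn : m + k ≤ n)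
    (hs : emptySpot f k < s) : countBelow f s + k < s := by
  rcases le_or_gt s n with hsn | hsn
  · exact not_le.1
      (Nat.findGreatest_is_greatest (P := fun s => s ≤ countBelow f s + k) hs hsn)
  · have := countBelow_le f s
    omega

theorem le_emptySpot {m n : ℕ} {f : Fin m → Fin n} {k s : ℕ} (hmn : m + k ≤ n)
    (hs : s ≤ countBelow f s + k) : s ≤ emptySpot f k := by
  by_contra! h
  exact absurd (lt_of_emptySpot_lt hmn h) (not_lt.2 hs)

theorem emptySpot_eq {m n : ℕ} {f : Fin m → Fin n} {k s : ℕ} (hmn : m + k ≤ n)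
    (hs : s ≤ countBelow f s + k) (h : ∀ t, s < t → countBelow f t + k < t) :
    emptySpot f k = s := by
  refine le_antisymm ?_ (le_emptySpot hmn hs)
  by_contra! hlt
  exact absurd (h _ hlt) (not_lt.2 (le_countBelow_emptySpot f k))

theorem countBelow_emptySpot_zero {m n : ℕ} {f : Fin m → Fin n} (hf : f ∈ revPF m n) :
    countBelow f (emptySpot f 0) = emptySpot f 0 :=
  le_antisymm (mem_revPF.1 hf _) (le_countBelow_emptySpot f 0)

theorem emptySpot_zero_lt {m n : ℕ} {f : Fin m → Fin n} (hf : f ∈ revPF m n) (hmn : m + 1 ≤ n) :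
    emptySpot f 0 < emptySpot f 1 := by
  refine le_emptySpot hmn ?_
  have := countBelow_mono f (Nat.le_succ (emptySpot f 0))
  rw [countBelow_emptySpot_zero hf] at this
  exact Nat.succ_le_succ this

theorem countBelow_emptySpot_one {m n : ℕ} {f : Fin m → Fin n} (hf : f ∈ revPF m n)
    (hmn : m + 1 ≤ n) : countBelow f (emptySpot f 1) + 1 = emptySpot f 1 :=
  le_antisymm (lt_of_emptySpot_lt (k := 0) (by omega) (emptySpot_zero_lt hf hmn))
    (le_countBelow_emptySpot f 1)

theorem emptySpot_one_lt {m n : ℕ} {f : Fin m → Fin n} (hf : f ∈ revPF m n) (hmn : m + 2 ≤ n) :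
    emptySpot f 1 < n := by
  have := countBelow_emptySpot_one hf (by omega)
  have := countBelow_le f (emptySpot f 1)
  omega

/-- Exchange the blocks of spots that end at the last and at the last but one empty spot, by a
cyclic shift of the spots `0, …, emptySpot f 1`. The minimum and the outer case distinction only
make this a total function; on `revPF m n` with `m + 2 ≤ n` they play no role (`val_swapBlocks`). -/
def swapBlocks {m n : ℕ} (f : Fin m → Fin n) (i : Fin m) : Fin n :=
  if h : emptySpot f 1 < n then
    if (f i : ℕ) ≤ emptySpot f 0 then
      ⟨min (f i + (emptySpot f 1 - emptySpot f 0)) (n - 1), by omega⟩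
    else if (f i : ℕ) ≤ emptySpot f 1 then ⟨f i - (emptySpot f 0 + 1), by omega⟩ else f i
  else f i

theorem val_swapBlocks {m n : ℕ} {f : Fin m → Fin n} (hf : f ∈ revPF m n) (hmn : m + 2 ≤ n)
    (i : Fin m) : (swapBlocks f i : ℕ) =
      if (f i : ℕ) ≤ emptySpot f 0 then f i + (emptySpot f 1 - emptySpot f 0)
      else if (f i : ℕ) ≤ emptySpot f 1 then f i - (emptySpot f 0 + 1) else f i := by
  have h1 := emptySpot_one_lt hf hmn
  have h0 := emptySpot_zero_lt hf (by omega)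
  unfold swapBlocks
  rw [dif_pos h1]
  split_ifs with h2 h3
  · exact min_eq_left (by omega)
  · rfl
  · rfl

/-- After the swap, the counts below the first empty spot are those of the second block. -/
theorem countBelow_swapBlocks_of_le {m n : ℕ} {f : Fin m → Fin n} (hf : f ∈ revPF m n)
    (hmn : m + 2 ≤ n) {s : ℕ} (hs : s ≤ emptySpot f 1 - emptySpot f 0) :
    emptySpot f 0 + countBelow (swapBlocks f) s = countBelow f (emptySpot f 0 + 1 + s) := by
  have h0 := emptySpot_zero_lt hf (by omega)
  have hL : countBelow f (emptySpot f 0 + 1) = emptySpot f 0 := by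
    refine le_antisymm ?_ ?_
    · exact Nat.le_of_lt_succ (lt_of_emptySpot_lt (k := 0) (by omega) (Nat.lt_succ_self _))
    · have := countBelow_mono f (Nat.le_succ (emptySpot f 0))
      rwa [countBelow_emptySpot_zero hf] at this
  have := countBelow_add_card f (a := emptySpot f 0 + 1) (b := emptySpot f 0 + 1 + s) (by omega)
  rw [← this, hL]
  congr 1
  unfold countBelow
  congr 1
  ext i
  simp only [Finset.mem_filter, Finset.mem_univ, true_and, val_swapBlocks hf hmn]
  split_ifs <;> omega

/-- After the swap, the counts in the second block are those of the first, shifted. -/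
theorem countBelow_swapBlocks_add {m n : ℕ} {f : Fin m → Fin n} (hf : f ∈ revPF m n)
    (hmn : m + 2 ≤ n) {s : ℕ} (hs : s ≤ emptySpot f 0 + 1) :
    countBelow (swapBlocks f) (s + (emptySpot f 1 - emptySpot f 0)) + 1 =
      countBelow f s + (emptySpot f 1 - emptySpot f 0) := by
  have h0 := emptySpot_zero_lt hf (by omega)
  have h1 := countBelow_swapBlocks_of_le hf hmn le_rfl
  have h2 : countBelow f (emptySpot f 0 + 1 + (emptySpot f 1 - emptySpot f 0)) + 1 =
      emptySpot f 1 := by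
    have h3 := countBelow_mono f (show emptySpot f 1 ≤
      emptySpot f 0 + 1 + (emptySpot f 1 - emptySpot f 0) by omega)
    have h4 := countBelow_emptySpot_one hf (by omega)
    have h5 := lt_of_emptySpot_lt (f := f) (k := 1) (by omega) (show emptySpot f 1 <
      emptySpot f 0 + 1 + (emptySpot f 1 - emptySpot f 0) by omega)
    omega
  have h6 := countBelow_add_card (swapBlocks f) (a := emptySpot f 1 - emptySpot f 0)
    (b := s + (emptySpot f 1 - emptySpot f 0)) (by omega)
  have h7 : (Finset.univ.filter fun i => emptySpot f 1 - emptySpot f 0 ≤ (swapBlocks f i : ℕ) ∧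
      (swapBlocks f i : ℕ) < s + (emptySpot f 1 - emptySpot f 0)).card = countBelow f s := by
    unfold countBelow
    congr 1
    ext i
    simp only [Finset.mem_filter, Finset.mem_univ, true_and, val_swapBlocks hf hmn]
    split_ifs <;> omega
  omega

theorem countBelow_swapBlocks_of_lt {m n : ℕ} {f : Fin m → Fin n} (hf : f ∈ revPF m n)
    (hmn : m + 2 ≤ n) {s : ℕ} (hs : emptySpot f 1 < s) :
    countBelow (swapBlocks f) s = countBelow f s := by
  have h0 := emptySpot_zero_lt hf (by omega)
  unfold countBelow
  congr 1
  ext i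
  simp only [Finset.mem_filter, Finset.mem_univ, true_and, val_swapBlocks hf hmn]
  split_ifs <;> omega

theorem countBelow_swapBlocks_lt {m n : ℕ} {f : Fin m → Fin n} (hf : f ∈ revPF m n)
    (hmn : m + 2 ≤ n) {s : ℕ} (hs : emptySpot f 1 - emptySpot f 0 ≤ s) :
    countBelow (swapBlocks f) s < s := by
  have h0 := emptySpot_zero_lt hf (by omega)
  rcases le_or_gt s (emptySpot f 1) with h | h
  · have h1 := countBelow_swapBlocks_add hf hmn
      (s := s - (emptySpot f 1 - emptySpot f 0)) (by omega)
    rw [Nat.sub_add_cancel hs] at h1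
    have := mem_revPF.1 hf (s - (emptySpot f 1 - emptySpot f 0))
    omega
  · rw [countBelow_swapBlocks_of_lt hf hmn h]
    have := lt_of_emptySpot_lt (f := f) (k := 1) (by omega) h
    omega

theorem swapBlocks_mem {m n : ℕ} {f : Fin m → Fin n} (hf : f ∈ revPF m n) (hmn : m + 2 ≤ n) :
    swapBlocks f ∈ revPF m n := by
  refine mem_revPF.2 fun s => ?_
  rcases le_or_gt (emptySpot f 1 - emptySpot f 0) s with h | h
  · exact (countBelow_swapBlocks_lt hf hmn h).le
  · have h1 := countBelow_swapBlocks_of_le hf hmn h.le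
    have := lt_of_emptySpot_lt (f := f) (k := 0) (by omega)
      (show emptySpot f 0 < emptySpot f 0 + 1 + s by omega)
    omega

theorem emptySpot_zero_swapBlocks {m n : ℕ} {f : Fin m → Fin n} (hf : f ∈ revPF m n)
    (hmn : m + 2 ≤ n) :
    emptySpot (swapBlocks f) 0 + 1 = emptySpot f 1 - emptySpot f 0 := by
  have h0 := emptySpot_zero_lt hf (by omega)
  have : emptySpot (swapBlocks f) 0 = emptySpot f 1 - emptySpot f 0 - 1 := by
    refine emptySpot_eq (by omega) ?_ fun t ht => countBelow_swapBlocks_lt hf hmn (by omega)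
    have h1 := countBelow_swapBlocks_of_le hf hmn
      (s := emptySpot f 1 - emptySpot f 0 - 1) (by omega)
    rw [show emptySpot f 0 + 1 + (emptySpot f 1 - emptySpot f 0 - 1) = emptySpot f 1 by omega] at h1
    have := countBelow_emptySpot_one hf (by omega)
    omega
  omega

theorem emptySpot_one_swapBlocks {m n : ℕ} {f : Fin m → Fin n} (hf : f ∈ revPF m n)
    (hmn : m + 2 ≤ n) : emptySpot (swapBlocks f) 1 = emptySpot f 1 := by
  have h0 := emptySpot_zero_lt hf (by omega)
  refine emptySpot_eq (by omega) ?_ fun t ht => ?_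
  · have h1 := countBelow_swapBlocks_add hf hmn (s := emptySpot f 0) (by omega)
    rw [show emptySpot f 0 + (emptySpot f 1 - emptySpot f 0) = emptySpot f 1 by omega,
      countBelow_emptySpot_zero hf] at h1
    omega
  · rw [countBelow_swapBlocks_of_lt hf hmn ht]
    exact lt_of_emptySpot_lt (by omega) ht

theorem swapBlocks_swapBlocks {m n : ℕ} {f : Fin m → Fin n} (hf : f ∈ revPF m n)
    (hmn : m + 2 ≤ n) : swapBlocks (swapBlocks f) = f := by
  have h0 := emptySpot_zero_lt hf (by omega)
  have h1 := emptySpot_zero_swapBlocks hf hmn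
  funext i
  apply Fin.ext
  rw [val_swapBlocks (swapBlocks_mem hf hmn) hmn, emptySpot_one_swapBlocks hf hmn,
    val_swapBlocks hf hmn]
  split_ifs <;> omega

/-- The last two blocks are equidistributed: swapping them is an involution. -/
theorem sum_emptySpot_one_sub {m n : ℕ} (hmn : m + 2 ≤ n) (g : ℕ → ℝ) :
    ∑ f ∈ revPF m n, g (emptySpot f 1 - emptySpot f 0) =
      ∑ f ∈ revPF m n, g (emptySpot f 0 + 1) :=
  Finset.sum_nbij' swapBlocks swapBlocks (fun _ hf => swapBlocks_mem hf hmn)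
    (fun _ hf => swapBlocks_mem hf hmn) (fun _ hf => swapBlocks_swapBlocks hf hmn)
    (fun _ hf => swapBlocks_swapBlocks hf hmn)
    fun _ hf => by rw [emptySpot_zero_swapBlocks hf hmn]

/-! ### Inserting one or two cars -/

theorem countBelow_cons {m n : ℕ} (j : Fin n) (f : Fin m → Fin n) (s : ℕ) :
    countBelow (Fin.cons j f : Fin (m + 1) → Fin n) s =
      (if (j : ℕ) < s then 1 else 0) + countBelow f s := by
  simp only [countBelow, Finset.card_filter, Fin.sum_univ_succ, Fin.cons_zero, Fin.cons_succ]

/-- The occupied spots do not depend on the order of the cars, so the inserted car may come last; it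
parks unless everything from its preferred spot to the end of the street is occupied. -/
theorem cons_mem_revPF {m n : ℕ} (hmn : m ≤ n) {j : Fin n} {f : Fin m → Fin n} :
    (Fin.cons j f : Fin (m + 1) → Fin n) ∈ revPF (m + 1) n ↔
      f ∈ revPF m n ∧ emptySpot f 0 ≤ j := by
  simp only [mem_revPF, countBelow_cons]
  constructor
  · refine fun h => ⟨fun s => le_trans (Nat.le_add_left _ _) (h s), ?_⟩
    by_contra! hlt
    have h1 := h (emptySpot f 0)
    have h2 := le_countBelow_emptySpot f 0
    rw [if_pos hlt] at h1
    omega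
  · rintro ⟨h, hj⟩ s
    split_ifs with hs
    · have := lt_of_emptySpot_lt (f := f) (k := 0) (by omega) (lt_of_le_of_lt hj hs)
      omega
    · simpa using h s

/-- Two inserted cars park unless one of them starts past the last empty spot, or both start past
the last but one. -/
theorem cons_cons_mem_revPF {m n : ℕ} (hmn : m + 1 ≤ n) {j k : Fin n} {f : Fin m → Fin n} :
    (Fin.cons j (Fin.cons k f : Fin (m + 1) → Fin n) : Fin (m + 2) → Fin n) ∈ revPF (m + 2) n ↔
      f ∈ revPF m n ∧ emptySpot f 0 ≤ j ∧ emptySpot f 0 ≤ k ∧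
        ¬((j : ℕ) < emptySpot f 1 ∧ (k : ℕ) < emptySpot f 1) := by
  simp only [mem_revPF, countBelow_cons]
  constructor
  · intro h
    have h1 := h (emptySpot f 0)
    have h2 := le_countBelow_emptySpot f 0
    refine ⟨fun s => ?_, ?_, ?_, ?_⟩
    · have := h s
      omega
    · by_contra! hlt
      rw [if_pos hlt] at h1
      omega
    · by_contra! hlt
      rw [if_pos hlt] at h1
      omega
    · rintro ⟨hj, hk⟩
      have h3 := h (emptySpot f 1)
      have h4 := le_countBelow_emptySpot f 1
      rw [if_pos hj, if_pos hk] at h3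
      omega
  · rintro ⟨h, hj, hk, hjk⟩ s
    have h0 := h s
    have h1 := lt_of_emptySpot_lt (f := f) (k := 0) (s := s) (by omega)
    have h2 := lt_of_emptySpot_lt (f := f) (k := 1) (s := s) (by omega)
    split_ifs <;> omega

theorem sum_fin_ite_eq_sum_Ico {n a b : ℕ} (hb : b ≤ n) (φ : ℕ → ℝ) :
    ∑ j : Fin n, (if a ≤ (j : ℕ) ∧ (j : ℕ) < b then φ j else 0) = ∑ j ∈ Finset.Ico a b, φ j := by
  rw [Fin.sum_univ_eq_sum_range (fun j => if a ≤ j ∧ j < b then φ j else 0) n,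
    ← Finset.sum_filter]
  congr 1
  ext j
  simp only [Finset.mem_filter, Finset.mem_range, Finset.mem_Ico]
  omega

theorem sum_fin_cons {m n : ℕ} (F : (Fin (m + 1) → Fin n) → ℝ) :
    ∑ f, F f = ∑ f : Fin m → Fin n, ∑ j, F (Fin.cons j f) := by
  rw [← (Fin.consEquiv fun _ => Fin n).sum_comp, Fintype.sum_prod_type, Finset.sum_comm]
  rfl

theorem sum_revPF_succ {m n : ℕ} (hmn : m ≤ n) (φ : ℕ → ℝ) :
    ∑ f ∈ revPF (m + 1) n, φ (f 0) =
      ∑ f ∈ revPF m n, ∑ j ∈ Finset.Ico (emptySpot f 0) n, φ j := by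
  classical
  simp_rw [← sum_fin_ite_eq_sum_Ico (le_refl n) φ]
  rw [← Fintype.sum_ite_mem (revPF _ n), ← Fintype.sum_ite_mem (revPF m n), sum_fin_cons]
  refine Finset.sum_congr rfl fun f _ => ?_
  by_cases h : f ∈ revPF m n <;> simp [cons_mem_revPF hmn, h]

theorem sum_revPF_add_two {m n : ℕ} (hmn : m + 1 ≤ n) (φ ψ : ℕ → ℝ) :
    ∑ f ∈ revPF (m + 2) n, φ (f 0) * ψ (f 1) =
      ∑ f ∈ revPF m n,
        ((∑ j ∈ Finset.Ico (emptySpot f 0) n, φ j) * (∑ j ∈ Finset.Ico (emptySpot f 0) n, ψ j) -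
          (∑ j ∈ Finset.Ico (emptySpot f 0) (emptySpot f 1), φ j) *
            ∑ j ∈ Finset.Ico (emptySpot f 0) (emptySpot f 1), ψ j) := by
  classical
  simp_rw [← sum_fin_ite_eq_sum_Ico (le_refl n),
    fun f : Fin m → Fin n =>
      (sum_fin_ite_eq_sum_Ico (a := emptySpot f 0) (emptySpot_le f 1) φ).symm,
    fun f : Fin m → Fin n =>
      (sum_fin_ite_eq_sum_Ico (a := emptySpot f 0) (emptySpot_le f 1) ψ).symm,
    Finset.sum_mul_sum, ← Finset.sum_sub_distrib]
  rw [← Fintype.sum_ite_mem (revPF _ n), ← Fintype.sum_ite_mem (revPF m n), sum_fin_cons,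
    sum_fin_cons]
  refine Finset.sum_congr rfl fun f _ => ?_
  rw [Finset.sum_comm]
  by_cases h : f ∈ revPF m n
  · rw [if_pos h]
    refine Finset.sum_congr rfl fun j _ => Finset.sum_congr rfl fun k _ => ?_
    have h10 : (Fin.cons j (Fin.cons k f : Fin (m + 1) → Fin n) : Fin (m + 2) → Fin n) 1 = k := rfl
    simp only [cons_cons_mem_revPF hmn, h, true_and, Fin.cons_zero, h10, j.isLt, k.isLt, and_true]
    by_cases h1 : emptySpot f 0 ≤ j <;> by_cases h2 : emptySpot f 0 ≤ k <;>
      by_cases h3 : (j : ℕ) < emptySpot f 1 <;> by_cases h4 : (k : ℕ) < emptySpot f 1 <;>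
      simp [h1, h2, h3, h4]
  · simp [cons_cons_mem_revPF hmn, h]

theorem card_revPF_succ {m n : ℕ} (hmn : m ≤ n) :
    ((revPF (m + 1) n).card : ℝ) = ∑ f ∈ revPF m n, ((n : ℝ) - emptySpot f 0) := by
  have := sum_revPF_succ hmn fun _ => 1
  simp only [Finset.sum_const, nsmul_eq_mul, mul_one, Nat.card_Ico] at this
  rw [this]
  exact Finset.sum_congr rfl fun f _ => Nat.cast_sub (emptySpot_le f 0)

/-- The squares of the two block lengths cancel up to a linear term, as the lengths are
equidistributed. -/
theorem card_revPF_add_two {m n : ℕ} (hmn : m + 2 ≤ n) :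
    ((revPF (m + 2) n).card : ℝ) =
      ∑ f ∈ revPF m n, (((n : ℝ) + 1) ^ 2 - 2 * (n + 1) * (emptySpot f 0 + 1)) := by
  have := sum_revPF_add_two (show m + 1 ≤ n by omega) (fun _ => 1) (fun _ => 1)
  simp only [Finset.sum_const, nsmul_eq_mul, mul_one, Nat.card_Ico, Finset.sum_sub_distrib] at this
  have hswap := sum_emptySpot_one_sub hmn fun b => (b : ℝ) * b
  rw [this, hswap, ← Finset.sum_sub_distrib]
  refine Finset.sum_congr rfl fun f _ => ?_
  rw [Nat.cast_sub (emptySpot_le f 0)]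
  push_cast
  ring

theorem revPF_zero (n : ℕ) : revPF 0 n = Finset.univ := by
  refine Finset.eq_univ_of_forall fun f => mem_revPF.2 fun s => ?_
  simp [countBelow]

/-- Both sums have a closed form: the number of parking functions of `m + 2` cars is a linear
function of these sums for `m`, by inserting two cars at once, and also of those for `m + 1`, by
inserting the cars one by one, which gives a recursion. -/
theorem sum_emptySpot_add_one_and_card {m n : ℕ} (hmn : m + 1 ≤ n) :
    ∑ f ∈ revPF m n, ((emptySpot f 0 : ℝ) + 1) = ((n : ℝ) + 1) ^ m ∧
      ((n : ℝ) + 1) * (revPF m n).card = (n + 1 - m) * (n + 1) ^ m := by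
  have hsucc : ∀ {m : ℕ}, m + 1 ≤ n → ((revPF (m + 1) n).card : ℝ) =
      (n + 1) * (revPF m n).card - ∑ f ∈ revPF m n, ((emptySpot f 0 : ℝ) + 1) := by
    intro m hm
    rw [card_revPF_succ (by omega), Finset.card_eq_sum_ones, Nat.cast_sum, Finset.mul_sum,
      ← Finset.sum_sub_distrib]
    exact Finset.sum_congr rfl fun f _ => by push_cast; ring
  induction m with
  | zero =>
    have h0 : ∀ f : Fin 0 → Fin n, emptySpot f 0 = 0 := fun f =>
      emptySpot_eq (by omega) (Nat.zero_le _) fun t ht => by simpa [countBelow] using ht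
    simp [revPF_zero, h0]
  | succ m ih =>
    obtain ⟨hT, hZ⟩ := ih (by omega)
    have h1 := hsucc (m := m) (by omega)
    have h2 := hsucc hmn
    have h3 : ((revPF (m + 2) n).card : ℝ) = (n + 1) ^ 2 * (revPF m n).card -
        2 * (n + 1) * ∑ f ∈ revPF m n, ((emptySpot f 0 : ℝ) + 1) := by
      rw [card_revPF_add_two hmn, Finset.card_eq_sum_ones, Nat.cast_sum, Finset.mul_sum,
        Finset.mul_sum, ← Finset.sum_sub_distrib]
      exact Finset.sum_congr rfl fun f _ => by push_cast; ring
    rw [hT] at h1 h3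
    constructor
    · rw [show m + 1 + 1 = m + 2 from rfl, h3, h1] at h2
      rw [pow_succ]
      linear_combination h2
    · rw [h1]
      push_cast
      rw [pow_succ]
      linear_combination ((n : ℝ) + 1) * hZ

/-! ### Exponential tails of the last block -/

theorem sum_pow_countBelow {m n s : ℕ} (hs : s ≤ n) (x : ℝ) :
    ∑ f : Fin m → Fin n, x ^ countBelow f s = ((n : ℝ) + s * (x - 1)) ^ m := by
  have h1 : ∑ j : Fin n, (if (j : ℕ) < s then x else 1) = (n : ℝ) + s * (x - 1) := by
    have h2 := sum_fin_ite_eq_sum_Ico (n := n) (a := 0) hs (fun _ => x - 1)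
    have h3 : ∀ j : Fin n, (if (j : ℕ) < s then x else 1) =
        1 + if 0 ≤ (j : ℕ) ∧ (j : ℕ) < s then x - 1 else 0 := fun j => by
      by_cases h : (j : ℕ) < s <;> simp [h]
    simp only [h3, Finset.sum_add_distrib, h2]
    simp [mul_sub]
  rw [← h1, Fintype.sum_pow]
  refine Finset.sum_congr rfl fun f _ => ?_
  rw [Finset.prod_ite]
  simp [countBelow]

/-- The exponential Markov inequality for a sum of independent indicators, with parameter `c⁻¹`. -/
theorem card_filter_emptySpot_eq_le {m n s : ℕ} {c : ℝ} (hc0 : 0 < c) (hc1 : c < 1)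
    (hs : s ≤ n) (hmc : (m : ℝ) ≤ c * (n + 1)) :
    (((revPF m n).filter fun f => emptySpot f 0 = s).card : ℝ) ≤
      ((n : ℝ) + 1) ^ m * (c * Real.exp (1 - c)) ^ s := by
  have hx : 1 ≤ c⁻¹ := (one_le_inv₀ hc0).2 hc1.le
  have hn : (0 : ℝ) < n + 1 := by positivity
  have hle : (((revPF m n).filter fun f => emptySpot f 0 = s).card : ℝ) * c⁻¹ ^ s ≤
      ((n : ℝ) + s * (c⁻¹ - 1)) ^ m := by
    rw [← sum_pow_countBelow hs, ← nsmul_eq_mul, ← Finset.sum_const]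
    refine le_trans (Finset.sum_le_sum fun f hf => ?_)
      (Finset.sum_le_univ_sum_of_nonneg fun f => by positivity)
    rw [← (Finset.mem_filter.1 hf).2]
    exact pow_le_pow_right₀ hx (le_countBelow_emptySpot f 0)
  have hexp : ((n : ℝ) + s * (c⁻¹ - 1)) ^ m ≤ (n + 1) ^ m * Real.exp (1 - c) ^ s := by
    have h1 : (n : ℝ) + s * (c⁻¹ - 1) ≤ (n + 1) * Real.exp (s * (c⁻¹ - 1) / (n + 1)) := by
      have := mul_le_mul_of_nonneg_left (Real.add_one_le_exp (s * (c⁻¹ - 1) / (n + 1))) hn.le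
      refine le_trans ?_ this
      rw [mul_add, mul_div_cancel₀ _ hn.ne']
      linarith
    have h0 : 0 ≤ (s : ℝ) * (c⁻¹ - 1) := mul_nonneg (Nat.cast_nonneg s) (by linarith)
    refine (pow_le_pow_left₀ (by positivity) h1 m).trans ?_
    rw [mul_pow, ← Real.exp_nat_mul, ← Real.exp_nat_mul]
    refine mul_le_mul_of_nonneg_left (Real.exp_le_exp.2 ?_) (by positivity)
    calc (m : ℝ) * (s * (c⁻¹ - 1) / (n + 1)) ≤ c * (n + 1) * (s * (c⁻¹ - 1) / (n + 1)) :=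
          mul_le_mul_of_nonneg_right hmc (by positivity)
      _ = s * (1 - c) := by field_simp
  have hpos : 0 < c⁻¹ ^ s := by positivity
  calc (((revPF m n).filter fun f => emptySpot f 0 = s).card : ℝ)
      = ((revPF m n).filter fun f => emptySpot f 0 = s).card * c⁻¹ ^ s * c ^ s := by
        rw [mul_assoc, ← mul_pow, inv_mul_cancel₀ hc0.ne', one_pow, mul_one]
    _ ≤ (n + 1) ^ m * Real.exp (1 - c) ^ s * c ^ s :=
        mul_le_mul_of_nonneg_right (hle.trans hexp) (by positivity)
    _ = _ := by rw [mul_pow]; ring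

/-- At a load bounded away from `1`, the third moment of the last block is bounded. -/
theorem exists_sum_emptySpot_pow_le {c : ℝ} (hc0 : 0 < c) (hc1 : c < 1) :
    ∃ B : ℝ, ∀ m n : ℕ, m + 1 ≤ n → (m : ℝ) ≤ c * (n + 1) →
      ∑ f ∈ revPF m n, ((emptySpot f 0 : ℝ) + 1) ^ 3 ≤ B * (revPF m n).card := by
  have hρ0 : 0 < c * Real.exp (1 - c) := by positivity
  have hρ1 : c * Real.exp (1 - c) < 1 := by
    have h1 : c < Real.exp (c - 1) := by
      have := Real.add_one_lt_exp (x := c - 1) (by linarith)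
      linarith
    calc c * Real.exp (1 - c) < Real.exp (c - 1) * Real.exp (1 - c) :=
          mul_lt_mul_of_pos_right h1 (Real.exp_pos _)
      _ = 1 := by rw [← Real.exp_add]; simp
  set ρ := c * Real.exp (1 - c) with hρ
  have hsum : Summable fun s : ℕ => ((s : ℝ) + 1) ^ 3 * ρ ^ s := by
    have h1 : Summable fun s : ℕ => (s : ℝ) ^ 3 * ρ ^ s :=
      summable_pow_mul_geometric_of_norm_lt_one 3 (by rwa [Real.norm_of_nonneg hρ0.le])
    refine (((summable_nat_add_iff 1).2 h1).mul_right ρ⁻¹).congr fun s => ?_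
    rw [pow_succ ρ s]
    push_cast
    field_simp
  refine ⟨(∑' s : ℕ, ((s : ℝ) + 1) ^ 3 * ρ ^ s) / (1 - c), fun m n hmn hmc => ?_⟩
  have hn : (0 : ℝ) < n + 1 := by positivity
  have hcard : (1 - c) * ((n : ℝ) + 1) ^ m ≤ (revPF m n).card := by
    have h1 := (sum_emptySpot_add_one_and_card hmn).2
    refine le_of_mul_le_mul_left ?_ hn
    rw [h1, ← mul_assoc]
    exact mul_le_mul_of_nonneg_right (by linarith) (by positivity)
  have hS0 : 0 ≤ ∑' s : ℕ, ((s : ℝ) + 1) ^ 3 * ρ ^ s := tsum_nonneg fun s => by positivity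
  calc ∑ f ∈ revPF m n, ((emptySpot f 0 : ℝ) + 1) ^ 3
      = ∑ s ∈ Finset.range (n + 1), ((revPF m n).filter fun f => emptySpot f 0 = s).card *
          ((s : ℝ) + 1) ^ 3 := by
        rw [← Finset.sum_fiberwise_of_maps_to (g := fun f => emptySpot f 0)
          (t := Finset.range (n + 1))
          fun f _ => Finset.mem_range.2 (Nat.lt_succ_of_le (emptySpot_le f 0))]
        refine Finset.sum_congr rfl fun s _ => ?_
        rw [← nsmul_eq_mul, ← Finset.sum_const]
        exact Finset.sum_congr rfl fun f hf => by rw [(Finset.mem_filter.1 hf).2]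
    _ ≤ ∑ s ∈ Finset.range (n + 1), (n + 1) ^ m * (((s : ℝ) + 1) ^ 3 * ρ ^ s) := by
        refine Finset.sum_le_sum fun s hs => ?_
        have := card_filter_emptySpot_eq_le hc0 hc1
          (Nat.lt_succ_iff.1 (Finset.mem_range.1 hs)) hmc
        rw [← hρ] at this
        calc _ ≤ ((n : ℝ) + 1) ^ m * ρ ^ s * ((s : ℝ) + 1) ^ 3 :=
              mul_le_mul_of_nonneg_right this (by positivity)
          _ = _ := by ring
    _ ≤ (n + 1) ^ m * ∑' s : ℕ, ((s : ℝ) + 1) ^ 3 * ρ ^ s := by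
        rw [← Finset.mul_sum]
        exact mul_le_mul_of_nonneg_left (hsum.sum_le_tsum _ fun s _ => by positivity)
          (by positivity)
    _ = (∑' s : ℕ, ((s : ℝ) + 1) ^ 3 * ρ ^ s) / (1 - c) * ((1 - c) * (n + 1) ^ m) := by
        have : 1 - c ≠ 0 := by linarith
        field_simp
    _ ≤ _ := mul_le_mul_of_nonneg_left hcard (div_nonneg hS0 (by linarith))

/-! ### Moments of the centred preferences -/

theorem sum_Ico_center {a b : ℕ} (hab : a ≤ b) (n : ℕ) :
    ∑ j ∈ Finset.Ico a b, ((j : ℝ) - (n - 1) / 2) = ((b : ℝ) - a) * (a + b - n) / 2 := by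
  induction b, hab using Nat.le_induction with
  | base => simp
  | succ b hab ih =>
    rw [Finset.sum_Ico_succ_top hab, ih]
    push_cast
    ring

theorem sum_Ico_center_sq {a n : ℕ} (han : a ≤ n) :
    ∑ j ∈ Finset.Ico a n, ((j : ℝ) - (n - 1) / 2) ^ 2 = (n : ℝ) * (n ^ 2 - 1) / 12 -
      (a * (a - 1) * (2 * a - 1) / 6 - (n - 1) * (a * (a - 1)) / 2 + a * (n - 1) ^ 2 / 4) := by
  have h : ∀ (t : ℝ) (b : ℕ), a ≤ b → ∑ j ∈ Finset.Ico a b, ((j : ℝ) - t) ^ 2 =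
      (b * (b - 1) * (2 * b - 1) / 6 - t * (b * (b - 1)) + b * t ^ 2) -
      ((a : ℝ) * (a - 1) * (2 * a - 1) / 6 - t * (a * (a - 1)) + a * t ^ 2) := by
    intro t b hab
    induction b, hab using Nat.le_induction with
    | base => simp
    | succ b hab ih =>
      rw [Finset.sum_Ico_succ_top hab, ih]
      push_cast
      ring
  rw [h _ n han]
  ring

/-- The average of `F` over the parking functions of `m` cars on `n` spots. -/
noncomputable def avg (m n : ℕ) (F : (Fin m → Fin n) → ℝ) : ℝ :=
  (∑ f ∈ revPF m n, F f) / (revPF m n).card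

/-- The deviation of the preference of car `i` from the middle of the street. -/
noncomputable def dev {m n : ℕ} (i : Fin m) (f : Fin m → Fin n) : ℝ :=
  ((f i : ℕ) : ℝ) - (n - 1) / 2

theorem card_revPF_pos {m n : ℕ} (hmn : m ≤ n) : 0 < ((revPF m n).card : ℝ) := by
  have : (fun i : Fin m => Fin.castLE hmn i) ∈ revPF m n := by
    refine mem_revPF.2 fun s => ?_
    unfold countBelow
    rw [← Finset.card_map Fin.valEmbedding]
    refine (Finset.card_le_card (t := Finset.range s) fun t ht => ?_).trans (by simp)
    obtain ⟨i, hi, rfl⟩ := Finset.mem_map.1 ht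
    simpa using hi
  exact_mod_cast Finset.card_pos.2 ⟨_, this⟩

/-- The mean length of the last block is `m / (n + 1 - m)`. -/
theorem sum_emptySpot_zero {m n : ℕ} (hmn : m + 1 ≤ n) :
    ∑ f ∈ revPF m n, (emptySpot f 0 : ℝ) = (m : ℝ) / (n + 1 - m) * (revPF m n).card := by
  obtain ⟨h1, h2⟩ := sum_emptySpot_add_one_and_card hmn
  have hpos : (0 : ℝ) < n + 1 - m := by
    have : (m : ℝ) + 1 ≤ n := by exact_mod_cast hmn
    linarith
  rw [Finset.sum_add_distrib] at h1
  simp only [Finset.sum_const, nsmul_eq_mul, mul_one] at h1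
  rw [div_mul_eq_mul_div, eq_div_iff hpos.ne']
  linear_combination ((n : ℝ) + 1 - m) * h1 - h2

theorem card_revPF_succ' {m n : ℕ} (hmn : m + 1 ≤ n) :
    ((revPF (m + 1) n).card : ℝ) = ((n : ℝ) - m / (n + 1 - m)) * (revPF m n).card := by
  rw [card_revPF_succ (by omega), Finset.sum_sub_distrib, sum_emptySpot_zero hmn]
  simp only [Finset.sum_const, nsmul_eq_mul]
  ring

theorem card_revPF_add_two' {m n : ℕ} (hmn : m + 2 ≤ n) :
    ((revPF (m + 2) n).card : ℝ) =
      (((n : ℝ) + 1) ^ 2 - 2 * (n + 1) * (m / (n + 1 - m) + 1)) * (revPF m n).card := by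
  rw [card_revPF_add_two hmn, Finset.sum_sub_distrib, ← Finset.mul_sum, Finset.sum_add_distrib,
    sum_emptySpot_zero (by omega)]
  simp only [Finset.sum_const, nsmul_eq_mul]
  ring

/-- A bound on the average over `m + r` cars from a summand-wise bound over `m` cars. -/
theorem abs_avg_mul_sub_le {m m' n : ℕ} {F : (Fin m' → Fin n) → ℝ} {G H K : (Fin m → Fin n) → ℝ}
    {B D W : ℝ} (hm' : 0 < ((revPF m' n).card : ℝ)) (hm : 0 < ((revPF m n).card : ℝ))
    (hF : ∑ f ∈ revPF m' n, F f = ∑ f ∈ revPF m n, G f)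
    (hD : ((revPF m' n).card : ℝ) = D * (revPF m n).card)
    (hH : ∑ f ∈ revPF m n, H f = W * (revPF m n).card)
    (hK : ∑ f ∈ revPF m n, K f ≤ B * (revPF m n).card)
    (hGH : ∀ f ∈ revPF m n, |G f - H f| ≤ K f) : |avg m' n F * D - W| ≤ B := by
  have h1 : avg m' n F * D - W = (∑ f ∈ revPF m n, (G f - H f)) / (revPF m n).card := by
    have hD0 : D ≠ 0 := fun h => by rw [h, zero_mul] at hD; exact hm'.ne' hD
    rw [avg, hF, hD, Finset.sum_sub_distrib, hH]
    field_simp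
  rw [h1, abs_div, abs_of_pos hm, div_le_iff₀ hm]
  exact (Finset.abs_sum_le_sum_abs _ _).trans ((Finset.sum_le_sum hGH).trans hK)

theorem abs_avg_dev_zero {m n : ℕ} {B : ℝ} (hmn : m + 1 ≤ n)
    (hB : ∑ f ∈ revPF m n, ((emptySpot f 0 : ℝ) + 1) ^ 3 ≤ B * (revPF m n).card) :
    |avg (m + 1) n (dev 0) * (n - m / (n + 1 - m)) - n * (m / (n + 1 - m)) / 2| ≤ B := by
  refine abs_avg_mul_sub_le (card_revPF_pos hmn) (card_revPF_pos (by omega))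
    (sum_revPF_succ (by omega) fun j => (j : ℝ) - (n - 1) / 2) (card_revPF_succ' hmn)
    (H := fun f => n * emptySpot f 0 / 2) ?_ hB fun f _ => ?_
  · rw [← Finset.sum_div, ← Finset.mul_sum, sum_emptySpot_zero hmn]
    ring
  · rw [sum_Ico_center (emptySpot_le f 0)]
    have ha : (0 : ℝ) ≤ emptySpot f 0 := Nat.cast_nonneg _
    generalize (emptySpot f 0 : ℝ) = a at *
    rw [show ((n : ℝ) - a) * (a + n - n) / 2 - n * a / 2 = -(a ^ 2 / 2) by ring, abs_neg,
      abs_of_nonneg (by positivity)]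
    nlinarith [pow_nonneg ha 3, pow_nonneg ha 2]

theorem abs_avg_dev_zero_sq {m n : ℕ} {B : ℝ} (hmn : m + 1 ≤ n)
    (hB : ∑ f ∈ revPF m n, ((emptySpot f 0 : ℝ) + 1) ^ 3 ≤ B * (revPF m n).card) :
    |avg (m + 1) n (fun f => dev 0 f * dev 0 f) * (n - m / (n + 1 - m)) -
      (n ^ 3 / 12 - m / (n + 1 - m) * n ^ 2 / 4)| ≤ 2 * B * n := by
  have hF := sum_revPF_succ (show m ≤ n by omega) fun j => ((j : ℝ) - (n - 1) / 2) ^ 2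
  simp only [sq] at hF
  refine abs_avg_mul_sub_le (card_revPF_pos hmn) (card_revPF_pos (by omega))
    hF (card_revPF_succ' hmn)
    (H := fun f => (n : ℝ) ^ 3 / 12 - (n : ℝ) ^ 2 / 4 * emptySpot f 0)
    (K := fun f => 2 * n * ((emptySpot f 0 : ℝ) + 1) ^ 3) ?_ ?_ fun f _ => ?_
  · rw [Finset.sum_sub_distrib, ← Finset.mul_sum, sum_emptySpot_zero hmn]
    simp only [Finset.sum_const, nsmul_eq_mul]
    ring
  · rw [← Finset.mul_sum]
    calc _ ≤ 2 * (n : ℝ) * (B * (revPF m n).card) := mul_le_mul_of_nonneg_left hB (by positivity)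
      _ = _ := by ring
  · simp only [← sq]
    rw [sum_Ico_center_sq (emptySpot_le f 0)]
    have ha : (0 : ℝ) ≤ emptySpot f 0 := Nat.cast_nonneg _
    have han : (emptySpot f 0 : ℝ) ≤ n := Nat.cast_le.2 (emptySpot_le f 0)
    have hn : (0 : ℝ) ≤ n := Nat.cast_nonneg _
    generalize (emptySpot f 0 : ℝ) = a at *
    generalize (n : ℝ) = x at *
    rw [abs_le]
    constructor <;>
    nlinarith [mul_nonneg ha hn, mul_nonneg (pow_nonneg ha 2) hn, mul_nonneg (pow_nonneg ha 3) hn,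
      mul_nonneg (pow_nonneg ha 2) (sub_nonneg.2 han), pow_nonneg ha 2, pow_nonneg ha 3]

theorem avg_dev_one {m n : ℕ} (hmn : m + 2 ≤ n) :
    avg (m + 2) n (dev 1) = avg (m + 2) n (dev 0) := by
  have h1 := sum_revPF_add_two (show m + 1 ≤ n by omega) (fun j => (j : ℝ) - (n - 1) / 2) fun _ => 1
  have h2 := sum_revPF_add_two (show m + 1 ≤ n by omega) (fun _ => 1) fun j => (j : ℝ) - (n - 1) / 2
  simp only [mul_comm (∑ j ∈ _, (1 : ℝ)), mul_one, one_mul] at h1 h2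
  unfold avg dev
  rw [h1, h2]

/-- The leading term is `n ^ 2 / 4` times the difference of `L ^ 2` and the square of the length of
the second block. As the lengths `L + 1` and `M - L` of the blocks are equidistributed, the second
moments cancel, and only the first moment of `L` is left. Here `L = emptySpot f 0` and
`M = emptySpot f 1`. -/
theorem abs_avg_dev_mul_dev {m n : ℕ} {B : ℝ} (hmn : m + 2 ≤ n)
    (hB : ∑ f ∈ revPF m n, ((emptySpot f 0 : ℝ) + 1) ^ 3 ≤ B * (revPF m n).card) :
    |avg (m + 2) n (fun f => dev 0 f * dev 1 f) *
        ((n + 1) ^ 2 - 2 * (n + 1) * (m / (n + 1 - m) + 1)) -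
      -(n ^ 2 * (2 * (m / (n + 1 - m)) + 1) / 4)| ≤ 4 * B * n := by
  have hF := sum_revPF_add_two (show m + 1 ≤ n by omega) (fun j => (j : ℝ) - (n - 1) / 2)
    fun j => (j : ℝ) - (n - 1) / 2
  have hsq := sum_emptySpot_one_sub hmn fun b => (b : ℝ) ^ 2
  have hcube := sum_emptySpot_one_sub hmn fun b => (b : ℝ) ^ 3
  push_cast at hsq hcube
  refine abs_avg_mul_sub_le (card_revPF_pos hmn) (card_revPF_pos (by omega))
    hF (card_revPF_add_two' hmn)
    (H := fun f => (n : ℝ) ^ 2 / 4 *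
      ((emptySpot f 0 : ℝ) ^ 2 - ((emptySpot f 1 - emptySpot f 0 : ℕ) : ℝ) ^ 2))
    (K := fun f => 2 * n * ((emptySpot f 0 : ℝ) + 1) ^ 3 +
      2 * n * ((emptySpot f 1 - emptySpot f 0 : ℕ) : ℝ) ^ 3) ?_ ?_ fun f hf => ?_
  · rw [← Finset.mul_sum, Finset.sum_sub_distrib, hsq, ← Finset.sum_sub_distrib]
    have : ∀ f : Fin m → Fin n, (emptySpot f 0 : ℝ) ^ 2 - (emptySpot f 0 + 1) ^ 2 =
        -2 * emptySpot f 0 - 1 := fun f => by ring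
    simp only [this]
    rw [Finset.sum_sub_distrib, ← Finset.mul_sum, sum_emptySpot_zero (by omega)]
    simp only [Finset.sum_const, nsmul_eq_mul]
    ring
  · rw [Finset.sum_add_distrib, ← Finset.mul_sum, ← Finset.mul_sum, hcube]
    have := mul_le_mul_of_nonneg_left hB (show (0 : ℝ) ≤ 4 * n by positivity)
    linarith
  · have h01 := emptySpot_zero_lt hf (by omega)
    rw [sum_Ico_center (emptySpot_le f 0), sum_Ico_center h01.le, Nat.cast_sub h01.le]
    have ha : (0 : ℝ) ≤ emptySpot f 0 := Nat.cast_nonneg _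
    have hab : (emptySpot f 0 : ℝ) ≤ emptySpot f 1 := Nat.cast_le.2 h01.le
    have hbn : (emptySpot f 1 : ℝ) ≤ n := Nat.cast_le.2 (emptySpot_le f 1)
    generalize (emptySpot f 0 : ℝ) = a at *
    obtain ⟨b, hb⟩ : ∃ b : ℝ, (emptySpot f 1 : ℝ) = a + b := ⟨_, (add_sub_cancel _ _).symm⟩
    rw [hb] at hab hbn ⊢
    generalize (n : ℝ) = x at *
    have hb0 : 0 ≤ b := by linarith
    have hx : 0 ≤ x := by linarith
    have hle : a * b ^ 2 ≤ a ^ 3 + b ^ 3 := by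
      nlinarith [mul_nonneg (add_nonneg ha hb0) (sq_nonneg (a - b)), mul_nonneg ha (sq_nonneg a),
        mul_nonneg hb0 (sq_nonneg a), mul_nonneg ha (sq_nonneg b)]
    -- Both error terms are nonnegative and at most a multiple of `x` times a sum of cubes.
    have h1 : 0 ≤ 2 * x * a ^ 3 - a ^ 4 := by
      nlinarith [mul_nonneg (pow_nonneg ha 3) (show 0 ≤ 2 * x - a by linarith)]
    have h2 : 0 ≤ b ^ 2 * (2 * a + b) * (2 * x - (2 * a + b)) :=
      mul_nonneg (mul_nonneg (sq_nonneg b) (by linarith)) (by linarith)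
    have h3 : b ^ 2 * (2 * a + b) * (2 * x - (2 * a + b)) ≤ 2 * x * (2 * a ^ 3 + 3 * b ^ 3) := by
      calc _ ≤ b ^ 2 * (2 * a + b) * (2 * x) := mul_le_mul_of_nonneg_left (by linarith)
            (mul_nonneg (sq_nonneg b) (by linarith))
        _ = 2 * x * (2 * (a * b ^ 2) + b ^ 3) := by ring
        _ ≤ _ := mul_le_mul_of_nonneg_left (by linarith) (by linarith)
    have h4 : 2 * x * a ^ 3 ≤ 2 * x * (a + 1) ^ 3 :=
      mul_le_mul_of_nonneg_left (pow_le_pow_left₀ ha (by linarith) 3) (by linarith)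
    have h5 : 0 ≤ x * b ^ 3 := mul_nonneg hx (pow_nonneg hb0 3)
    have h6 : 0 ≤ x * a ^ 3 := mul_nonneg hx (pow_nonneg ha 3)
    have h7 : 0 ≤ a ^ 4 := pow_nonneg ha 4
    rw [show (x - a) * (a + x - x) / 2 * ((x - a) * (a + x - x) / 2) -
        (a + b - a) * (a + (a + b) - x) / 2 * ((a + b - a) * (a + (a + b) - x) / 2) -
        x ^ 2 / 4 * (a ^ 2 - (a + b - a) ^ 2) = (b ^ 2 * (2 * a + b) * (2 * x - (2 * a + b)) -
        (2 * x * a ^ 3 - a ^ 4)) / 4 by ring, abs_le, add_sub_cancel_left]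
    constructor <;> linarith

/-! ### The uniform measure on parking functions -/

/-- Numbering the spots from the far end turns the uniform measure into the average `avg`. -/
theorem integral_unifPF {m n : ℕ} (g : (Fin m → Fin n) → ℝ) :
    ∫ π, g (fun i => (π i).rev) ∂unifPF m n = avg m n g := by
  classical
  set e : (Fin m → Fin n) ≃ (Fin m → Fin n) := (Equiv.refl _).arrowCongr Fin.revPerm
  have he : ∀ π i, e π i = (π i).rev := fun _ _ => rfl
  have hS : PF m n = ((revPF m n).map e.symm.toEmbedding : Finset _) := by
    ext π
    rw [mem_PF_iff, Finset.mem_coe, Finset.mem_map_equiv, Equiv.symm_symm]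
    rfl
  have hcount : (Measure.count (PF m n)) = ((revPF m n).card : ENNReal) := by
    rw [hS, Measure.count_apply_finset, Finset.card_map]
  rw [unifPF, uniformOn, ProbabilityTheory.cond, integral_smul_measure, hcount, hS,
    setIntegral_finset _ (Integrable.of_finite).integrableOn, Finset.sum_map]
  have hr : ∀ f, (fun i => (e.symm f i).rev) = f := fun f => e.apply_symm_apply f
  simp only [Equiv.coe_toEmbedding, hr, Measure.real, Measure.count_singleton]
  simp [avg, div_eq_inv_mul]

theorem isProbabilityMeasure_unifPF {m n : ℕ} (hmn : m ≤ n) :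
    IsProbabilityMeasure (unifPF m n) := by
  refine isProbabilityMeasure_uniformOn (Set.toFinite _) ?_
  obtain ⟨f, hf⟩ := Finset.card_pos.1 (Nat.cast_pos.1 (card_revPF_pos hmn))
  exact ⟨fun i => (f i).rev, mem_PF_iff.2 (by simpa using hf)⟩

theorem pref_eq {m n : ℕ} (i : Fin m) :
    pref (n := n) i = fun π => ((n : ℝ) + 1) / 2 - dev i (fun i => (π i).rev) := by
  funext π
  have h : (((π i).rev : ℕ) : ℝ) = n - (π i + 1) := by
    rw [Fin.val_rev, Nat.cast_sub (Nat.succ_le_of_lt (π i).isLt)]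
    push_cast
    ring
  rw [pref, dev, h]
  ring

theorem covariance_pref {m n : ℕ} (hmn : m ≤ n) (i j : Fin m) :
    cov[pref i, pref j; unifPF m n] = avg m n (fun f => dev i f * dev j f) -
      avg m n (dev i) * avg m n (dev j) := by
  have := isProbabilityMeasure_unifPF hmn
  rw [pref_eq, pref_eq, covariance_const_sub_left .of_finite,
    covariance_const_sub_right .of_finite, neg_neg, covariance_eq_sub .of_discrete .of_discrete]
  congr 1
  · exact integral_unifPF fun f => dev i f * dev j f
  · exact congrArg₂ _ (integral_unifPF (dev i)) (integral_unifPF (dev j))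

/-! ### Asymptotics -/

theorem tendsto_div_sq_zero {n : ℕ → ℕ} (hn : Tendsto n atTop atTop) {e : ℕ → ℝ} {C : ℝ}
    (he : ∀ᶠ k in atTop, |e k| ≤ C * n k) :
    Tendsto (fun k => e k / (n k : ℝ) ^ 2) atTop (𝓝 0) := by
  have hn' : Tendsto (fun k => (n k : ℝ)) atTop atTop := tendsto_natCast_atTop_atTop.comp hn
  refine squeeze_zero_norm' ?_ (hn'.const_div_atTop C)
  filter_upwards [he, hn'.eventually_gt_atTop 0] with k hk hpos
  rw [Real.norm_eq_abs, abs_div, abs_of_pos (pow_pos hpos 2), div_le_div_iff₀ (pow_pos hpos 2) hpos]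
  nlinarith

theorem tendsto_mean_emptySpot {c : ℝ} (hc1 : c < 1) {p n : ℕ → ℕ} (hn : Tendsto n atTop atTop)
    (hp : Tendsto (fun k => (p k : ℝ) / n k) atTop (𝓝 c)) :
    Tendsto (fun k => (p k : ℝ) / (n k + 1 - p k)) atTop (𝓝 (c / (1 - c))) := by
  have hn' : Tendsto (fun k => (n k : ℝ)) atTop atTop := tendsto_natCast_atTop_atTop.comp hn
  have h1 : Tendsto (fun k => (p k : ℝ) / n k / (1 + 1 / n k - p k / n k)) atTop
      (𝓝 (c / (1 + 0 - c))) :=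
    hp.div ((tendsto_const_nhds.add (hn'.const_div_atTop 1)).sub hp) (by linarith)
  rw [add_zero] at h1
  refine h1.congr' ?_
  filter_upwards [hn'.eventually_gt_atTop 0] with k hk
  rw [div_div, mul_sub, mul_add, mul_div_cancel₀ _ hk.ne', mul_div_cancel₀ _ hk.ne', mul_one]

theorem tendsto_sub_div {c : ℝ} {m n : ℕ → ℕ} (a : ℕ) (hn : Tendsto n atTop atTop)
    (hma : ∀ k, a ≤ m k) (hmn : Tendsto (fun k => (m k : ℝ) / n k) atTop (𝓝 c)) :
    Tendsto (fun k => ((m k - a : ℕ) : ℝ) / n k) atTop (𝓝 c) := by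
  have hn' : Tendsto (fun k => (n k : ℝ)) atTop atTop := tendsto_natCast_atTop_atTop.comp hn
  have h := hmn.sub (hn'.const_div_atTop (a : ℝ))
  rw [sub_zero] at h
  refine h.congr fun k => ?_
  rw [Nat.cast_sub (hma k), sub_div]

/-- The asymptotic analysis of the exact recursions, in terms of abstract sequences: `l` is the mean
length of the last block, `u` the mean and `v` the second moment of a centred preference. -/
theorem tendsto_mean_and_variance {n : ℕ → ℕ} (hn : Tendsto n atTop atTop) {l u v : ℕ → ℝ}
    {a C : ℝ} (hl : Tendsto l atTop (𝓝 a))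
    (hu : ∀ᶠ k in atTop, |u k * (n k - l k) - n k * l k / 2| ≤ C)
    (hv : ∀ᶠ k in atTop, |v k * (n k - l k) - ((n k : ℝ) ^ 3 / 12 - l k * n k ^ 2 / 4)| ≤
      C * n k) :
    Tendsto u atTop (𝓝 (a / 2)) ∧
      Tendsto (fun k => (v k - u k * u k - (1 / 12 * (n k : ℝ) ^ 2 - a / 6 * n k)) / n k) atTop
        (𝓝 0) := by
  have hn' : Tendsto (fun k => (n k : ℝ)) atTop atTop := tendsto_natCast_atTop_atTop.comp hn
  have hinv : Tendsto (fun k => 1 / (n k : ℝ)) atTop (𝓝 0) := hn'.const_div_atTop 1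
  have hln : Tendsto (fun k => l k * (1 / n k)) atTop (𝓝 0) := by simpa using hl.mul hinv
  have hden : Tendsto (fun k => 1 - l k * (1 / n k)) atTop (𝓝 1) := by
    simpa using tendsto_const_nhds.sub hln
  have hne : ∀ᶠ k in atTop, 1 - l k * (1 / n k) ≠ 0 := hden.eventually_ne one_ne_zero
  -- The error terms, divided by the appropriate power of `n`.
  have heu : Tendsto (fun k => (u k * (n k - l k) - n k * l k / 2) * (1 / n k)) atTop (𝓝 0) := by
    refine squeeze_zero_norm' ?_ (hn'.const_div_atTop C)
    filter_upwards [hu] with k hk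
    rw [norm_mul, Real.norm_eq_abs, Real.norm_of_nonneg (by positivity : 0 ≤ 1 / (n k : ℝ)),
      mul_one_div]
    exact div_le_div_of_nonneg_right hk (Nat.cast_nonneg _)
  have hev := tendsto_div_sq_zero hn hv
  have hu' : Tendsto u atTop (𝓝 (a / 2)) := by
    have h1 := ((hl.div_const 2).add heu).div hden one_ne_zero
    rw [add_zero, div_one] at h1
    refine h1.congr' ?_
    filter_upwards [hne, hn'.eventually_gt_atTop 0] with k hk hpos
    rw [Pi.div_apply, div_eq_iff hk]
    field_simp
    ring
  refine ⟨hu', ?_⟩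
  have h1 := (hev.sub (((hl.mul hl).div_const 6).mul hinv)).div hden one_ne_zero
  have h2 := (h1.sub ((hu'.mul hu').mul hinv)).add
    (((tendsto_const_nhds (x := a)).sub hl).div_const 6)
  simp only [mul_zero, sub_self, zero_div, add_zero] at h2
  refine h2.congr' ?_
  filter_upwards [hne, hn'.eventually_gt_atTop 0] with k hk hpos
  have hk' : (n k : ℝ) - l k ≠ 0 := by
    intro h0
    apply hk
    rw [← sub_eq_zero.1 h0]
    field_simp
    ring
  rw [Pi.div_apply]
  field_simp
  ring

/-- As `tendsto_mean_and_variance`, where `w` is the mixed second moment of two centred preferences;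
the limits of `w` and of `u * u` are of the same order, so the constant terms matter. -/
theorem tendsto_covariance {n : ℕ → ℕ} (hn : Tendsto n atTop atTop) {l u w : ℕ → ℝ}
    {a C : ℝ} (hl : Tendsto l atTop (𝓝 a)) (hu : Tendsto u atTop (𝓝 (a / 2)))
    (hw : ∀ᶠ k in atTop, |w k * (((n k : ℝ) + 1) ^ 2 - 2 * (n k + 1) * (l k + 1)) -
      -((n k : ℝ) ^ 2 * (2 * l k + 1) / 4)| ≤ C * n k) :
    Tendsto (fun k => w k - u k * u k) atTop (𝓝 (-((a + 1) ^ 2 / 4))) := by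
  have hn' : Tendsto (fun k => (n k : ℝ)) atTop atTop := tendsto_natCast_atTop_atTop.comp hn
  have hinv : Tendsto (fun k => 1 / (n k : ℝ)) atTop (𝓝 0) := hn'.const_div_atTop 1
  have h1inv : Tendsto (fun k => 1 + 1 / (n k : ℝ)) atTop (𝓝 1) := by
    simpa using tendsto_const_nhds.add hinv
  have hden : Tendsto (fun k => (1 + 1 / (n k : ℝ)) ^ 2 -
      2 * (1 + 1 / (n k : ℝ)) * (l k + 1) * (1 / n k)) atTop (𝓝 1) := by
    have := (h1inv.pow 2).sub (((h1inv.const_mul 2).mul (hl.add_const 1)).mul hinv)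
    simpa using this
  have hw' : Tendsto w atTop (𝓝 (-(2 * a + 1) / 4)) := by
    have h1 := (((((hl.const_mul 2).add_const 1).neg).div_const 4).add
      (tendsto_div_sq_zero hn hw)).div hden one_ne_zero
    rw [add_zero, div_one] at h1
    refine h1.congr' ?_
    filter_upwards [hden.eventually_ne one_ne_zero, hn'.eventually_gt_atTop 0] with k hk hpos
    rw [Pi.div_apply, div_eq_iff hk]
    field_simp
    ring
  have h2 := hw'.sub (hu.mul hu)
  convert h2 using 2
  ring

end Parking

theorem mainTheorem6 (c : ℝ) (hc0 : 0 < c) (hc1 : c < 1)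
    (m n : ℕ → ℕ) (hm : ∀ k, 2 ≤ m k)
    (hn : Tendsto n atTop atTop)
    (hmn : Tendsto (fun k => (m k : ℝ) / (n k : ℝ)) atTop (𝓝 c)) :
    ((fun k => Var[Parking.pref (⟨0, lt_of_lt_of_le Nat.zero_lt_two (hm k)⟩ : Fin (m k));
          Parking.unifPF (m k) (n k)]
        - ((1 / 12 : ℝ) * (n k : ℝ) ^ 2 - c / (6 * (1 - c)) * (n k : ℝ)))
      =o[atTop] (fun k => (n k : ℝ))) ∧
    ((fun k => cov[Parking.pref (⟨0, lt_of_lt_of_le Nat.zero_lt_two (hm k)⟩ : Fin (m k)),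
          Parking.pref (⟨1, lt_of_lt_of_le Nat.one_lt_two (hm k)⟩ : Fin (m k));
          Parking.unifPF (m k) (n k)])
      ~[atTop] (fun _ => -(1 / (4 * (1 - c) ^ 2)))) := by
  obtain ⟨p, rfl⟩ : ∃ p : ℕ → ℕ, m = fun k => p k + 2 :=
    ⟨fun k => m k - 2, funext fun k => (Nat.sub_add_cancel (hm k)).symm⟩
  have hn' : Tendsto (fun k => (n k : ℝ)) atTop atTop := tendsto_natCast_atTop_atTop.comp hn
  have h1c : 1 - c ≠ 0 := by linarith
  -- Any bound on the load strictly between `c` and `1` makes the moment bound available.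
  obtain ⟨d, hcd, hd1⟩ := exists_between hc1
  obtain ⟨B, hB⟩ := Parking.exists_sum_emptySpot_pow_le (hc0.trans hcd) hd1
  have hp1 := Parking.tendsto_sub_div 1 hn (fun k => (hm k).trans' one_le_two) hmn
  have hp2 := Parking.tendsto_sub_div 2 hn hm hmn
  simp only [Nat.add_sub_cancel, show ∀ k, p k + 2 - 1 = p k + 1 from fun _ => rfl] at hp1 hp2
  have hl1 := Parking.tendsto_mean_emptySpot hc1 hn hp1
  have hl2 := Parking.tendsto_mean_emptySpot hc1 hn hp2
  have hload : ∀ᶠ k in atTop, p k + 2 ≤ n k ∧ ((p k + 2 : ℕ) : ℝ) ≤ d * (n k + 1) := by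
    filter_upwards [hmn.eventually (gt_mem_nhds hcd), hn'.eventually_gt_atTop 0] with k hk hpos
    rw [div_lt_iff₀ hpos] at hk
    have hd0 := hc0.trans hcd
    refine ⟨?_, by linarith⟩
    have : ((p k + 2 : ℕ) : ℝ) < n k := by nlinarith
    exact (Nat.cast_lt.1 this).le
  have hload1 : ∀ᶠ k in atTop, p k + 2 ≤ n k ∧ ∑ f ∈ Parking.revPF (p k + 1) (n k),
      ((Parking.emptySpot f 0 : ℝ) + 1) ^ 3 ≤ B * (Parking.revPF (p k + 1) (n k)).card := by
    filter_upwards [hload] with k hk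
    have := hk.2
    push_cast at this
    exact ⟨hk.1, hB _ _ (by omega) (by push_cast; linarith)⟩
  have hload2 : ∀ᶠ k in atTop, p k + 2 ≤ n k ∧ ∑ f ∈ Parking.revPF (p k) (n k),
      ((Parking.emptySpot f 0 : ℝ) + 1) ^ 3 ≤ B * (Parking.revPF (p k) (n k)).card := by
    filter_upwards [hload] with k hk
    have := hk.2
    push_cast at this
    exact ⟨hk.1, hB _ _ (by omega) (by linarith)⟩
  obtain ⟨hu, hv⟩ := Parking.tendsto_mean_and_variance hn (C := max B (2 * B)) hl1
    (u := fun k => Parking.avg (p k + 1 + 1) (n k) (Parking.dev 0))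
    (v := fun k => Parking.avg (p k + 1 + 1) (n k) fun f => Parking.dev 0 f * Parking.dev 0 f)
    (by
      filter_upwards [hload1] with k hk
      exact (Parking.abs_avg_dev_zero hk.1 hk.2).trans (le_max_left _ _))
    (by
      filter_upwards [hload1] with k hk
      exact (Parking.abs_avg_dev_zero_sq hk.1 hk.2).trans
        (mul_le_mul_of_nonneg_right (le_max_right _ _) (Nat.cast_nonneg _)))
  have hw := Parking.tendsto_covariance hn hl2 hu
    (w := fun k => Parking.avg (p k + 2) (n k) fun f => Parking.dev 0 f * Parking.dev 1 f)
    (hload2.mono fun k hk => Parking.abs_avg_dev_mul_dev hk.1 hk.2)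
  constructor
  · rw [isLittleO_iff_tendsto' ((hn'.eventually_gt_atTop 0).mono fun k hk h0 =>
      absurd h0 hk.ne')]
    refine hv.congr' ?_
    filter_upwards [hload] with k hk
    rw [← covariance_self (by fun_prop), Parking.covariance_pref hk.1, div_div, mul_comm (1 - c)]
    rfl
  · refine (isEquivalent_const_iff_tendsto (neg_ne_zero.2 (one_div_ne_zero
      (mul_ne_zero four_ne_zero (pow_ne_zero 2 h1c))))).2 ?_
    have ha : -((c / (1 - c) + 1) ^ 2 / 4) = -(1 / (4 * (1 - c) ^ 2)) := by
      field_simp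
      ring
    rw [ha] at hw
    refine hw.congr' ?_
    filter_upwards [hload] with k hk
    rw [Parking.covariance_pref hk.1]
    have h1 := Parking.avg_dev_one hk.1
    congr 1
    exact congrArg₂ _ rfl h1.symm
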